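/- \textbf{Setting.} A plant $P$ is a real finite-dimensional linear time-invariant system with a given realization $(A_P,B_P,C_P,D_P)$, $n_u$ inputs and $n_y$ outputs. A controller $K$ (from measurements to inputs) is such a system $(A_K,B_K,C_K,D_K)$ of arbitrary finite order. It is static if $A_K,B_K,C_K$ are zero. An information structure $\mathcal S$ is given by a set $\mathrm{Adm}(\mathcal S)$ of admissible index pairs: $K\in\mathcal S$ means that the entry $(i,j)$ of the transfer function $C_K(sI-A_K)^{-1}B_K+D_K$ vanishes identically for every $(i,j)\notin\mathrm{Adm}(\mathcal S)$. The loop of $P$ and $K$ is well posed if $I-D_KD_P$ is invertible; then, with $M=(I-D_KD_P)^{-1}$ and $N=(I-D_PD_K)^{-1}$, put $$A_{\mathrm{CL}}(P,K)=\begin{pmatrix}A_P+B_PMD_KC_P & B_PMC_K\\ B_KNC_P & A_K+B_KD_PMC_K\end{pmatrix},$$ and let $F(P,K)$ be the closed loop with realization $$\Bigl(A_{\mathrm{CL}}(P,K),\ \begin{pmatrix}B_PM\\ B_KD_PM\end{pmatrix},\ \begin{pmatrix}NC_P & D_PMC_K\end{pmatrix},\ D_PM\Bigr).$$ The static fixed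 modes of $P$ with respect to $\mathcal S$ are the complex numbers that are eigenvalues of $A_{\mathrm{CL}}(P,K)$ for every static $K\in\mathcal S$ whose loop with $P$ is well posed. The unstable eigenvalues of a system are the eigenvalues of its dynamics matrix with real part $\ge 0$. \textbf{Lemma.} Let $P$ be a plant all of whose static fixed modes with respect to $\mathcal S$ lie in the open left half-plane $\{\Re\lambda<0\}$. Let $K_m\in\mathcal S$ be a (possibly dynamic) controller whose loop with $P$ is well posed, and suppose that no unstable eigenvalue of $K_m$ is an unstable eigenvalue of the closed loop $F(P,K_m)$. Then all static fixed modes of $F(P,K_m)$ with respect to $\mathcal S$ also lie in the open left half-plane. -/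

import Mathlib

noncomputable section

/-- A real state-space realization `(A, B, C, D)` of a finite-dimensional linear time-invariant
system with state coordinates `ι`, input coordinates `u` and output coordinates `y`. -/
structure StateSpace (ι u y : Type*) where
  A : Matrix ι ι ℝ
  B : Matrix ι u ℝ
  C : Matrix y ι ℝ
  D : Matrix y u ℝ

/-- The set of complex eigenvalues of a real square matrix. -/
def eig {ι : Type*} [Fintype ι] [DecidableEq ι] (A : Matrix ι ι ℝ) : Set ℂ :=
  spectrum ℂ (A.map (algebraMap ℝ ℂ))

/-- The open left half-plane. -/
def openLHP : Set ℂ := {z | z.re < 0}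

/-- The closed right half-plane, the complement of the open left half-plane. -/
def closedRHP : Set ℂ := {z | 0 ≤ z.re}

namespace StateSpace

variable {ι κ u y : Type*} [Fintype ι] [DecidableEq ι] [Fintype κ] [DecidableEq κ]
  [Fintype u] [DecidableEq u] [Fintype y] [DecidableEq y]

/-- The open-loop modes in the closed right half-plane. -/
def unstableModes (P : StateSpace ι u y) : Set ℂ := eig P.A ∩ closedRHP

/-- The value at `s` of the transfer function `C (s I - A)⁻¹ B + D`; meaningful for `s` outside
the spectrum of `A`. -/
def transfer (P : StateSpace ι u y) (s : ℂ) : Matrix y u ℂ :=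
  P.C.map (algebraMap ℝ ℂ) * (s • (1 : Matrix ι ι ℂ) - P.A.map (algebraMap ℝ ℂ))⁻¹ *
    P.B.map (algebraMap ℝ ℂ) + P.D.map (algebraMap ℝ ℂ)

/-- The controller `K` (from measurements `y` to inputs `u`) satisfies the information constraint
with admissible index set `Adm`: the entry `(i, j)` of its transfer function vanishes identically
whenever `(i, j)` is not admissible. -/
def IsSparse (Adm : Set (u × y)) (K : StateSpace κ y u) : Prop :=
  ∀ i j, (i, j) ∉ Adm → ∀ s : ℂ, s ∉ eig K.A → K.transfer s i j = 0

/-- Static systems: only the feedthrough matrix may be nonzero. -/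
def IsStatic (K : StateSpace κ y u) : Prop := K.A = 0 ∧ K.B = 0 ∧ K.C = 0

/-- The feedback interconnection of `P` and `K` is well posed. -/
def WellPosed (P : StateSpace ι u y) (K : StateSpace κ y u) : Prop :=
  IsUnit (1 - K.D * P.D)

/-- `M = (I - D_K D_P)⁻¹`. -/
def loopM (P : StateSpace ι u y) (K : StateSpace κ y u) : Matrix u u ℝ := (1 - K.D * P.D)⁻¹

/-- `N = (I - D_P D_K)⁻¹`. -/
def loopN (P : StateSpace ι u y) (K : StateSpace κ y u) : Matrix y y ℝ := (1 - P.D * K.D)⁻¹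

/-- The closed-loop dynamics matrix. -/
def closedLoopA (P : StateSpace ι u y) (K : StateSpace κ y u) : Matrix (ι ⊕ κ) (ι ⊕ κ) ℝ :=
  Matrix.fromBlocks
    (P.A + P.B * loopM P K * K.D * P.C) (P.B * loopM P K * K.C)
    (K.B * loopN P K * P.C) (K.A + K.B * P.D * loopM P K * K.C)

/-- The closed loop `F(P, K)`: the realization of the map `r ↦ y` when `u = r + K y` is closed
around `y = P u`. -/
def closedLoop (P : StateSpace ι u y) (K : StateSpace κ y u) : StateSpace (ι ⊕ κ) u y where
  A := closedLoopA P K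
  B := Matrix.fromRows (P.B * loopM P K) (K.B * P.D * loopM P K)
  C := Matrix.fromCols (loopN P K * P.C) (P.D * loopM P K * K.C)
  D := P.D * loopM P K

end StateSpace

/-- Controllers of arbitrary finite order, from measurements `y` to inputs `u`. -/
abbrev Controller (u y : Type*) := Σ k : ℕ, StateSpace (Fin k) y u

namespace Controller

variable {u y : Type*}

/-- The controllers satisfying the information constraint with admissible index set `Adm`. -/
def sparse (Adm : Set (u × y)) : Set (Controller u y) := {K | K.2.IsSparse Adm}

/-- The static controllers. -/
def static (u y : Type*) : Set (Controller u y) := {K | K.2.IsStatic}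

end Controller

/-- The fixed modes of `P` with respect to a set `S` of structured controllers and a set `T` of
controllers of a given type: the common closed-loop eigenvalues over all controllers in `S ∩ T`
whose interconnection with `P` is well posed. -/
def fixedModes {ι u y : Type*} [Fintype ι] [DecidableEq ι] [Fintype u] [DecidableEq u]
    [Fintype y] [DecidableEq y] (P : StateSpace ι u y) (S T : Set (Controller u y)) : Set ℂ :=
  {z | ∀ K ∈ S ∩ T, P.WellPosed K.2 → z ∈ eig (P.closedLoopA K.2)}

end

/-!
Let `z` be a static fixed mode of the closed loop `F(P, K)` with `0 ≤ re z`. The zero gain is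
admissible, so `z` is an eigenvalue of the closed loop, hence by assumption not an eigenvalue of
`K`, and the transfer matrix `G` of `K` at `z` is a well-defined complex matrix with the sparsity
pattern `Adm`.

For a complex gain `X` put `φ X = det [[z - A, -B], [-X C, 1 - X D]]`, which is polynomial in the
entries of `X` and vanishes exactly if the plant has a nonzero signal of the form `exp (z t)` in
feedback with `X` (`StateSpace.returnMatrix`). Closing a real static gain `Δ` around `F(P, K)` is
the same as closing `K + Δ` around `P`, and on exponentials of rate `z` the controller `K + Δ` acts
as the constant gain `G + Δ`. Hence `φ (G + Δ) = 0` for every real sparse `Δ` whose loop with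
`F(P, K)` is well posed. Well-posedness is the nonvanishing of a polynomial in `Δ` that is not
zero, and real points are Zariski dense, so `Δ ↦ φ (G + Δ)` is the zero polynomial in the
admissible entries of `Δ` (`StateSpace.det_returnMatrix_eq_zero_of_real_gains`). As `G` is itself
sparse, `φ` vanishes at every sparse complex gain, in particular at every real one, so that `z` is
a static fixed mode of `P`: this is excluded by the assumption on `P`.

Eigenvectors of closed loops are handled through the signals `(x, ξ, u, y)` of the loop
(`StateSpace.WellPosed.mem_eig_closedLoopA_iff`).
-/

open Matrix

/-- The complexification of a real matrix. -/
noncomputable abbrev Matrix.toComplex {m n : Type*} (A : Matrix m n ℝ) : Matrix m n ℂ :=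
  A.map (algebraMap ℝ ℂ)

section Complexification

variable {m n p : Type*}

theorem Matrix.toComplex_mul [Fintype n] (A : Matrix m n ℝ) (B : Matrix n p ℝ) :
    (A * B).toComplex = A.toComplex * B.toComplex :=
  Matrix.map_mul

theorem Matrix.toComplex_add (A B : Matrix m n ℝ) :
    (A + B).toComplex = A.toComplex + B.toComplex :=
  Matrix.map_add _ (map_add _) A B

theorem Matrix.toComplex_sub (A B : Matrix m n ℝ) :
    (A - B).toComplex = A.toComplex - B.toComplex :=
  Matrix.map_sub _ (map_sub _) A B

theorem Matrix.toComplex_one [DecidableEq n] : (1 : Matrix n n ℝ).toComplex = 1 :=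
  Matrix.map_one _ (map_zero _) (map_one _)

theorem Matrix.toComplex_zero : (0 : Matrix m n ℝ).toComplex = 0 :=
  Matrix.map_zero _ (map_zero _)

end Complexification

theorem mem_eig_iff {ι : Type*} [Fintype ι] [DecidableEq ι] (A : Matrix ι ι ℝ) (z : ℂ) :
    z ∈ eig A ↔ ∃ v : ι → ℂ, v ≠ 0 ∧ A.toComplex *ᵥ v = z • v := by
  rw [eig, spectrum.mem_iff, Matrix.isUnit_iff_isUnit_det, isUnit_iff_ne_zero, not_not,
    ← Matrix.exists_mulVec_eq_zero_iff]
  refine exists_congr fun v => and_congr_right fun _ => ?_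
  rw [Matrix.sub_mulVec, sub_eq_zero, Algebra.algebraMap_eq_smul_one, Matrix.smul_mulVec,
    Matrix.one_mulVec, eq_comm]

/-! ### Static controllers -/

namespace StateSpace

section Static

variable {κ u y : Type*} [Fintype κ] [DecidableEq κ]

theorem IsStatic.D_apply_eq_zero {K : StateSpace κ y u} (hK : K.IsStatic)
    {Adm : Set (u × y)} (hS : K.IsSparse Adm) {i : u} {j : y} (hij : (i, j) ∉ Adm) :
    K.D i j = 0 := by
  -- The transfer function is evaluated at `1`, which is not an eigenvalue of the zero matrix.
  have h1 : (1 : ℂ) ∉ eig K.A := by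
    rw [mem_eig_iff]
    rintro ⟨v, hv, hv1⟩
    rw [hK.1, toComplex_zero, Matrix.zero_mulVec, one_smul] at hv1
    exact hv hv1.symm
  have h2 := hS i j hij 1 h1
  rw [transfer, hK.2.1] at h2
  simpa using h2

/-- The controller of order zero with feedthrough matrix `Δ`. -/
def ofGain (Δ : Matrix u y ℝ) : StateSpace (Fin 0) y u := ⟨0, 0, 0, Δ⟩

theorem isSparse_ofGain {Adm : Set (u × y)} {Δ : Matrix u y ℝ}
    (hΔ : ∀ i j, (i, j) ∉ Adm → Δ i j = 0) : (ofGain Δ).IsSparse Adm := by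
  intro i j hij s _
  simp [transfer, ofGain, hΔ i j hij]

end Static

/-! ### Signals of a feedback loop -/

variable {ι κ u y : Type*} [Fintype u] [DecidableEq u] [Fintype y]

theorem WellPosed.mul_loopM {P : StateSpace ι u y} {K : StateSpace κ y u}
    (h : P.WellPosed K) : (1 - K.D * P.D) * loopM P K = 1 :=
  Matrix.mul_nonsing_inv _ ((Matrix.isUnit_iff_isUnit_det _).1 h)

theorem WellPosed.loopM_mul {P : StateSpace ι u y} {K : StateSpace κ y u}
    (h : P.WellPosed K) : loopM P K * (1 - K.D * P.D) = 1 :=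
  Matrix.nonsing_inv_mul _ ((Matrix.isUnit_iff_isUnit_det _).1 h)

theorem WellPosed.loopN_eq [DecidableEq y] {P : StateSpace ι u y} {K : StateSpace κ y u}
    (h : P.WellPosed K) : loopN P K = 1 + P.D * loopM P K * K.D := by
  refine Matrix.inv_eq_right_inv ?_
  calc (1 - P.D * K.D) * (1 + P.D * loopM P K * K.D)
      = 1 - P.D * K.D + P.D * ((1 - K.D * P.D) * loopM P K) * K.D := by
        simp only [Matrix.mul_add, Matrix.sub_mul, Matrix.mul_sub, Matrix.one_mul,
          Matrix.mul_one, Matrix.mul_assoc]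
    _ = 1 := by rw [h.mul_loopM]; simp

variable [Fintype ι] [Fintype κ]

/-- The plant input produced in the loop of `P` and `K` by the states `x`, `ξ` and the exogenous
input `r`. -/
noncomputable def loopInput (P : StateSpace ι u y) (K : StateSpace κ y u) (x : ι → ℂ) (ξ : κ → ℂ)
    (r : u → ℂ) : u → ℂ :=
  (loopM P K).toComplex *ᵥ (K.D.toComplex *ᵥ P.C.toComplex *ᵥ x + K.C.toComplex *ᵥ ξ + r)

/-- The plant output produced in the loop of `P` and `K` by the states `x`, `ξ` and the exogenous
input `r`. -/
noncomputable def loopOutput (P : StateSpace ι u y) (K : StateSpace κ y u) (x : ι → ℂ) (ξ : κ → ℂ)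
    (r : u → ℂ) : y → ℂ :=
  P.C.toComplex *ᵥ x + P.D.toComplex *ᵥ loopInput P K x ξ r

variable {P : StateSpace ι u y} {K : StateSpace κ y u}

theorem WellPosed.loopInput_eq (h : P.WellPosed K) (x : ι → ℂ) (ξ : κ → ℂ) (r : u → ℂ) :
    loopInput P K x ξ r =
      K.C.toComplex *ᵥ ξ + K.D.toComplex *ᵥ loopOutput P K x ξ r + r := by
  have h1 := congrArg Matrix.toComplex h.mul_loopM
  rw [toComplex_mul, toComplex_sub, toComplex_mul, toComplex_one] at h1
  have h2 := congrArg
    (· *ᵥ (K.D.toComplex *ᵥ P.C.toComplex *ᵥ x + K.C.toComplex *ᵥ ξ + r)) h1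
  simp only [← Matrix.mulVec_mulVec, Matrix.sub_mulVec, Matrix.one_mulVec] at h2
  rw [loopOutput, Matrix.mulVec_add]
  change loopInput P K x ξ r - K.D.toComplex *ᵥ P.D.toComplex *ᵥ loopInput P K x ξ r = _ at h2
  rw [sub_eq_iff_eq_add] at h2
  refine h2.trans ?_
  abel

/-- In a well-posed loop the states determine the plant input. -/
theorem WellPosed.eq_loopInput (h : P.WellPosed K) {x : ι → ℂ} {ξ : κ → ℂ} {v : u → ℂ}
    (hv : v = K.C.toComplex *ᵥ ξ +
      K.D.toComplex *ᵥ (P.C.toComplex *ᵥ x + P.D.toComplex *ᵥ v)) :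
    v = loopInput P K x ξ 0 := by
  have h1 := congrArg Matrix.toComplex h.loopM_mul
  rw [toComplex_mul, toComplex_sub, toComplex_mul, toComplex_one] at h1
  have h2 := congrArg (· *ᵥ v) h1
  simp only [← Matrix.mulVec_mulVec, Matrix.sub_mulVec, Matrix.one_mulVec] at h2
  rw [loopInput, ← h2]
  congr 1
  nth_rewrite 1 [hv]
  rw [Matrix.mulVec_add]
  abel

variable [DecidableEq y]

/-- The state equation of `F(P, K)`, rewritten as the state equations of `P` and `K` driven by the
signals of the loop. -/
theorem WellPosed.closedLoopA_mulVec_add (h : P.WellPosed K) (x : ι → ℂ) (ξ : κ → ℂ)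
    (r : u → ℂ) :
    (closedLoopA P K).toComplex *ᵥ Sum.elim x ξ + (P.closedLoop K).B.toComplex *ᵥ r =
      Sum.elim (P.A.toComplex *ᵥ x + P.B.toComplex *ᵥ loopInput P K x ξ r)
        (K.A.toComplex *ᵥ ξ + K.B.toComplex *ᵥ loopOutput P K x ξ r) := by
  have hB : (P.closedLoop K).B.toComplex = Matrix.fromRows (P.B * loopM P K).toComplex
      (K.B * P.D * loopM P K).toComplex := by
    ext (i | i) j <;> rfl
  rw [hB, closedLoopA, toComplex, Matrix.fromBlocks_map, Matrix.fromBlocks_mulVec,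
    Matrix.fromRows_mulVec, h.loopN_eq]
  simp only [Sum.elim_comp_inl, Sum.elim_comp_inr]
  ext (i | i) <;>
  · simp only [toComplex_mul, toComplex_add, toComplex_one, loopInput, loopOutput,
      Matrix.add_mulVec, Matrix.mulVec_add, ← Matrix.mulVec_mulVec, Matrix.one_mulVec,
      Pi.add_apply, Sum.elim_inl, Sum.elim_inr]
    ring

theorem WellPosed.closedLoop_output (h : P.WellPosed K) (x : ι → ℂ) (ξ : κ → ℂ) (r : u → ℂ) :
    (P.closedLoop K).C.toComplex *ᵥ Sum.elim x ξ + (P.closedLoop K).D.toComplex *ᵥ r =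
      loopOutput P K x ξ r := by
  have hC : (P.closedLoop K).C.toComplex = Matrix.fromCols (loopN P K * P.C).toComplex
      (P.D * loopM P K * K.C).toComplex := by
    ext i (j | j) <;> rfl
  rw [hC, Matrix.fromCols_mulVec, h.loopN_eq]
  simp only [Sum.elim_comp_inl, Sum.elim_comp_inr, closedLoop]
  simp only [toComplex_mul, toComplex_add, toComplex_one, loopInput, loopOutput,
      Matrix.add_mulVec, Matrix.mulVec_add, ← Matrix.mulVec_mulVec, Matrix.one_mulVec]
  abel

variable [DecidableEq ι] [DecidableEq κ]

/-- The closed-loop eigenvalues are the rates `z` of the nonzero signals of the loop that are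
exponential in time. -/
theorem WellPosed.mem_eig_closedLoopA_iff (h : P.WellPosed K) (z : ℂ) :
    z ∈ eig (closedLoopA P K) ↔ ∃ (x : ι → ℂ) (ξ : κ → ℂ) (v : u → ℂ) (w : y → ℂ),
      (x ≠ 0 ∨ ξ ≠ 0) ∧
      P.A.toComplex *ᵥ x + P.B.toComplex *ᵥ v = z • x ∧
      w = P.C.toComplex *ᵥ x + P.D.toComplex *ᵥ v ∧
      K.A.toComplex *ᵥ ξ + K.B.toComplex *ᵥ w = z • ξ ∧
      v = K.C.toComplex *ᵥ ξ + K.D.toComplex *ᵥ w := by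
  have key (x : ι → ℂ) (ξ : κ → ℂ) := h.closedLoopA_mulVec_add x ξ 0
  simp only [Matrix.mulVec_zero, add_zero] at key
  rw [mem_eig_iff]
  constructor
  · rintro ⟨s, hs, hz⟩
    obtain ⟨x, ξ, rfl⟩ : ∃ x ξ, s = Sum.elim x ξ :=
      ⟨s ∘ Sum.inl, s ∘ Sum.inr, (Sum.elim_comp_inl_inr s).symm⟩
    rw [key] at hz
    refine ⟨x, ξ, loopInput P K x ξ 0, loopOutput P K x ξ 0, ?_, ?_, rfl, ?_, ?_⟩
    · by_contra! hx
      exact hs (by rw [hx.1, hx.2]; ext (i | i) <;> rfl)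
    · exact funext fun i => congrFun hz (Sum.inl i)
    · exact funext fun i => congrFun hz (Sum.inr i)
    · simpa using h.loopInput_eq x ξ 0
  · rintro ⟨x, ξ, v, w, hne, hx, rfl, hξ, hv⟩
    refine ⟨Sum.elim x ξ, fun h0 => ?_, ?_⟩
    · rcases hne with hne | hne
      · exact hne (funext fun i => congrFun h0 (Sum.inl i))
      · exact hne (funext fun i => congrFun h0 (Sum.inr i))
    · have hv' := h.eq_loopInput hv
      rw [key, loopOutput, ← hv', hx, hξ]
      ext (i | i) <;> rfl

/-! ### The return matrix -/

/-- The matrix of the homogeneous equations `z x = A x + B v`, `v = X (C x + D v)` satisfied by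
the exponential signals of rate `z` of the plant `P` in feedback with the complex gain `X`. -/
noncomputable def returnMatrix (P : StateSpace ι u y) (z : ℂ) (X : Matrix u y ℂ) :
    Matrix (ι ⊕ u) (ι ⊕ u) ℂ :=
  Matrix.fromBlocks (z • 1 - P.A.toComplex) (-P.B.toComplex)
    (-(X * P.C.toComplex)) (1 - X * P.D.toComplex)

omit [DecidableEq y] in
theorem returnMatrix_mulVec (P : StateSpace ι u y) (z : ℂ) (X : Matrix u y ℂ) (x : ι → ℂ)
    (v : u → ℂ) :
    P.returnMatrix z X *ᵥ Sum.elim x v =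
      Sum.elim (z • x - (P.A.toComplex *ᵥ x + P.B.toComplex *ᵥ v))
        (v - X *ᵥ (P.C.toComplex *ᵥ x + P.D.toComplex *ᵥ v)) := by
  rw [returnMatrix, Matrix.fromBlocks_mulVec]
  simp only [Sum.elim_comp_inl, Sum.elim_comp_inr, Matrix.sub_mulVec, Matrix.neg_mulVec,
    Matrix.smul_mulVec, Matrix.one_mulVec, ← Matrix.mulVec_mulVec, Matrix.mulVec_add]
  congr 1 <;> abel

omit [DecidableEq y] in
theorem det_returnMatrix_eq_zero_iff (P : StateSpace ι u y) (z : ℂ) (X : Matrix u y ℂ) :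
    (P.returnMatrix z X).det = 0 ↔ ∃ (x : ι → ℂ) (v : u → ℂ), (x ≠ 0 ∨ v ≠ 0) ∧
      P.A.toComplex *ᵥ x + P.B.toComplex *ᵥ v = z • x ∧
      v = X *ᵥ (P.C.toComplex *ᵥ x + P.D.toComplex *ᵥ v) := by
  rw [← Matrix.exists_mulVec_eq_zero_iff]
  constructor
  · rintro ⟨s, hs, hz⟩
    obtain ⟨x, v, rfl⟩ : ∃ x v, s = Sum.elim x v :=
      ⟨s ∘ Sum.inl, s ∘ Sum.inr, (Sum.elim_comp_inl_inr s).symm⟩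
    rw [returnMatrix_mulVec] at hz
    refine ⟨x, v, ?_, ?_, ?_⟩
    · by_contra! hx
      exact hs (by rw [hx.1, hx.2]; ext (i | i) <;> rfl)
    · exact (sub_eq_zero.1 (funext fun i => congrFun hz (Sum.inl i))).symm
    · exact sub_eq_zero.1 (funext fun i => congrFun hz (Sum.inr i))
  · rintro ⟨x, v, hne, hx, hv⟩
    refine ⟨Sum.elim x v, fun h0 => ?_, ?_⟩
    · rcases hne with hne | hne
      · exact hne (funext fun i => congrFun h0 (Sum.inl i))
      · exact hne (funext fun i => congrFun h0 (Sum.inr i))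
    · rw [returnMatrix_mulVec, hx, ← hv, sub_self, sub_self]
      ext (i | i) <;> rfl

/-- Away from the eigenvalues of `K`, a mode of the closed loop `F(P, K)` under the static gain
`Δ` is a mode of `P` under the complex gain `K(z) + Δ`. -/
theorem WellPosed.det_returnMatrix_transfer_add (h : P.WellPosed K)
    {L : StateSpace (Fin 0) y u} (hL : (P.closedLoop K).WellPosed L) {z : ℂ}
    (hzK : z ∉ eig K.A) (hz : z ∈ eig ((P.closedLoop K).closedLoopA L)) :
    (P.returnMatrix z (K.transfer z + L.D.toComplex)).det = 0 := by
  obtain ⟨s, η, r, w, hne, hs, hw, -, hr⟩ := (hL.mem_eig_closedLoopA_iff z).1 hz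
  obtain rfl : η = 0 := Subsingleton.elim _ _
  obtain ⟨x, ξ, rfl⟩ : ∃ x ξ, s = Sum.elim x ξ :=
    ⟨s ∘ Sum.inl, s ∘ Sum.inr, (Sum.elim_comp_inl_inr s).symm⟩
  rw [h.closedLoop_output] at hw
  change (closedLoopA P K).toComplex *ᵥ Sum.elim x ξ + _ = _ at hs
  rw [h.closedLoopA_mulVec_add] at hs
  rw [Matrix.mulVec_zero, zero_add] at hr
  have hx : P.A.toComplex *ᵥ x + P.B.toComplex *ᵥ loopInput P K x ξ r = z • x :=
    funext fun i => congrFun hs (Sum.inl i)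
  have hξ : K.A.toComplex *ᵥ ξ + K.B.toComplex *ᵥ w = z • ξ := by
    rw [hw]; exact funext fun i => congrFun hs (Sum.inr i)
  have hin := h.loopInput_eq x ξ r
  rw [← hw] at hin
  -- `z` is not an eigenvalue of `K`, so the controller state is determined by the measurement.
  have hres : IsUnit (z • (1 : Matrix κ κ ℂ) - K.A.toComplex).det := by
    rw [eig, spectrum.mem_iff, not_not, Algebra.algebraMap_eq_smul_one,
      Matrix.isUnit_iff_isUnit_det] at hzK
    exact hzK
  have hξ' : ξ = (z • (1 : Matrix κ κ ℂ) - K.A.toComplex)⁻¹ *ᵥ K.B.toComplex *ᵥ w := by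
    have h1 : K.B.toComplex *ᵥ w = (z • (1 : Matrix κ κ ℂ) - K.A.toComplex) *ᵥ ξ := by
      rw [Matrix.sub_mulVec, Matrix.smul_mulVec, Matrix.one_mulVec, ← hξ]
      abel
    rw [h1, Matrix.mulVec_mulVec, Matrix.nonsing_inv_mul _ hres, Matrix.one_mulVec]
  refine (det_returnMatrix_eq_zero_iff _ _ _).2 ⟨x, loopInput P K x ξ r, ?_, hx, ?_⟩
  · by_contra! h0
    have hw0 : w = 0 := by rw [hw, loopOutput, h0.2, h0.1]; simp
    have hξ0 : ξ = 0 := by rw [hξ', hw0]; simp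
    rcases hne with hne | hne
    · exact hne (by rw [h0.1, hξ0]; ext (i | i) <;> rfl)
    · exact hne rfl
  · change _ = _ *ᵥ loopOutput P K x ξ r
    rw [← hw, hin, hr, Matrix.add_mulVec, transfer, Matrix.add_mulVec, ← Matrix.mulVec_mulVec,
      ← Matrix.mulVec_mulVec, ← hξ']

theorem WellPosed.mem_eig_closedLoopA_of_isStatic (h : P.WellPosed K) (hK : K.IsStatic) {z : ℂ}
    (hz : (P.returnMatrix z K.D.toComplex).det = 0) : z ∈ eig (P.closedLoopA K) := by
  obtain ⟨x, v, hne, hx, hv⟩ := (det_returnMatrix_eq_zero_iff _ _ _).1 hz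
  refine (h.mem_eig_closedLoopA_iff z).2 ⟨x, 0, v, _, Or.inl fun hx0 => ?_, hx, rfl, ?_, ?_⟩
  · have hv0 : v = loopInput P K x 0 0 := h.eq_loopInput (by simpa using hv)
    rw [hx0] at hv0
    exact hne.elim (· hx0) (· (by rw [hv0, loopInput]; simp))
  · rw [hK.2.1, toComplex_zero]; simp
  · simpa using hv

end StateSpace

/-! ### Zariski density of the real gains -/

/-- Real points are Zariski dense, even in the complement of a hypersurface. -/
theorem MvPolynomial.eq_zero_of_eval_ofReal {σ : Type*} {f g : MvPolynomial σ ℂ} (hg : g ≠ 0)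
    (h : ∀ a : σ → ℝ, eval (fun i => (a i : ℂ)) g ≠ 0 → eval (fun i => (a i : ℂ)) f = 0) :
    f = 0 := by
  refine (mul_eq_zero.1 ?_).resolve_right hg
  refine MvPolynomial.funext_set (fun _ => Set.range ((↑) : ℝ → ℂ))
    (fun _ => Set.infinite_range_of_injective Complex.ofReal_injective) fun x hx => ?_
  choose a ha using fun i => hx i (Set.mem_univ i)
  obtain rfl : (fun i => (a i : ℂ)) = x := _root_.funext ha
  rw [map_mul, map_zero]
  by_cases hga : eval (fun i => (a i : ℂ)) g = 0
  · rw [hga, mul_zero]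
  · rw [h a hga, zero_mul]

/-- A matrix regarded as a matrix of constant polynomials in the variables `σ`. -/
noncomputable abbrev Matrix.toConst {R m n : Type*} [CommSemiring R] (A : Matrix m n R)
    (σ : Type*) : Matrix m n (MvPolynomial σ R) :=
  A.map MvPolynomial.C

theorem Matrix.toConst_map_eval {σ R m n : Type*} [CommSemiring R] (a : σ → R)
    (A : Matrix m n R) : (A.toConst σ).map (MvPolynomial.eval a) = A := by
  ext i j
  simp

namespace StateSpace

variable {ι u y : Type*}

open scoped Classical in
/-- The gain matrix with entries `a (i, j)` at the admissible positions and `0` elsewhere. -/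
noncomputable def sparseGain {R : Type*} [Zero R] (Adm : Set (u × y))
    (a : u × y → R) : Matrix u y R :=
  Matrix.of fun i j => if (i, j) ∈ Adm then a (i, j) else 0

theorem map_sparseGain {R S : Type*} [Semiring R] [Semiring S] (f : R →+* S) (Adm : Set (u × y))
    (a : u × y → R) : (sparseGain Adm a).map f = sparseGain Adm (fun p => f (a p)) := by
  ext i j
  simp only [sparseGain, Matrix.map_apply, Matrix.of_apply, apply_ite f, map_zero]

theorem sparseGain_eq {R : Type*} [Zero R] {Adm : Set (u × y)} {X : Matrix u y R}
    (hX : ∀ i j, (i, j) ∉ Adm → X i j = 0) : sparseGain Adm (fun p => X p.1 p.2) = X := by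
  ext i j
  simp only [sparseGain, Matrix.of_apply]
  split_ifs with hij
  · rfl
  · exact (hX i j hij).symm

variable [Fintype ι] [DecidableEq ι] [Fintype u] [DecidableEq u] [Fintype y]

/-- If the return determinant of `P` vanishes at `G + Δ` for all real sparse `Δ` outside a
hypersurface, then it vanishes at all sparse complex gains, provided `G` is sparse. -/
theorem det_returnMatrix_eq_zero_of_real_gains (P : StateSpace ι u y) (z : ℂ)
    {Adm : Set (u × y)} {G : Matrix u y ℂ} (hG : ∀ i j, (i, j) ∉ Adm → G i j = 0)
    (E : Matrix y u ℝ)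
    (h : ∀ Δ : Matrix u y ℝ, (∀ i j, (i, j) ∉ Adm → Δ i j = 0) → IsUnit (1 - Δ * E) →
      (P.returnMatrix z (G + Δ.toComplex)).det = 0)
    {X : Matrix u y ℂ} (hX : ∀ i j, (i, j) ∉ Adm → X i j = 0) :
    (P.returnMatrix z X).det = 0 := by
  -- `f` and `g` are the two determinants at the generic sparse gain `T`, shifted by `G` in `f`.
  let T : Matrix u y (MvPolynomial (u × y) ℂ) := sparseGain Adm MvPolynomial.X
  let f : MvPolynomial (u × y) ℂ := (Matrix.fromBlocks
    ((z • 1 - P.A.toComplex).toConst (u × y)) ((-P.B.toComplex).toConst (u × y))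
    (-((G.toConst (u × y) + T) * P.C.toComplex.toConst (u × y)))
    (1 - (G.toConst (u × y) + T) * P.D.toComplex.toConst (u × y))).det
  let g : MvPolynomial (u × y) ℂ := (1 - T * E.toComplex.toConst (u × y)).det
  have hT (a : u × y → ℂ) : T.map (MvPolynomial.eval a) = sparseGain Adm a := by
    simp only [T, map_sparseGain, MvPolynomial.eval_X]
  have hf (a : u × y → ℂ) :
      MvPolynomial.eval a f = (P.returnMatrix z (G + sparseGain Adm a)).det := by
    simp only [f, RingHom.map_det, RingHom.mapMatrix_apply, Matrix.fromBlocks_map]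
    rw [returnMatrix]
    congr 2
    · exact toConst_map_eval a _
    · exact toConst_map_eval a _
    · rw [Matrix.map_neg _ (map_neg _), Matrix.map_mul, Matrix.map_add _ (map_add _),
        toConst_map_eval, toConst_map_eval, hT]
    · rw [Matrix.map_sub _ (map_sub _), Matrix.map_one _ (map_zero _) (map_one _),
        Matrix.map_mul, Matrix.map_add _ (map_add _), toConst_map_eval, toConst_map_eval, hT]
  have hg (a : u × y → ℂ) :
      MvPolynomial.eval a g = (1 - sparseGain Adm a * E.toComplex).det := by
    simp only [g, RingHom.map_det, RingHom.mapMatrix_apply]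
    rw [Matrix.map_sub _ (map_sub _), Matrix.map_one _ (map_zero _) (map_one _),
      Matrix.map_mul, toConst_map_eval, hT]
  have hg0 : g ≠ 0 := by
    intro h0
    have h1 := hg 0
    have h2 : sparseGain Adm (0 : u × y → ℂ) = 0 := by ext i j; simp [sparseGain]
    rw [h0, h2] at h1
    simp at h1
  have hf0 : f = 0 := by
    refine MvPolynomial.eq_zero_of_eval_ofReal hg0 fun a ha => ?_
    have hΔ : (sparseGain Adm a).toComplex = sparseGain Adm (fun p => (a p : ℂ)) :=
      map_sparseGain _ _ _
    rw [hf, ← hΔ]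
    refine h _ (fun i j hij => by simp [sparseGain, hij]) ?_
    rw [hg, ← hΔ, ← toComplex_mul, ← toComplex_one, ← toComplex_sub] at ha
    rw [Matrix.isUnit_iff_isUnit_det, isUnit_iff_ne_zero]
    intro h0
    refine ha ?_
    have := RingHom.map_det (algebraMap ℝ ℂ) (1 - sparseGain Adm a * E)
    rw [h0, map_zero] at this
    exact this.symm
  have hXG := hf fun p => (X - G) p.1 p.2
  rw [hf0, map_zero, sparseGain_eq (X := X - G) fun i j hij => by simp [hX i j hij, hG i j hij],
    add_sub_cancel] at hXG
  exact hXG.symm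

end StateSpace

open StateSpace in
theorem mainTheorem9 {ι κ u y : Type*} [Fintype ι] [DecidableEq ι] [Fintype κ] [DecidableEq κ]
    [Fintype u] [DecidableEq u] [Fintype y] [DecidableEq y]
    (P : StateSpace ι u y) (Adm : Set (u × y))
    (hP : fixedModes P (Controller.sparse Adm) (Controller.static u y) ⊆ openLHP)
    (K : StateSpace κ y u) (hK : K.IsSparse Adm) (hPK : P.WellPosed K)
    (hdisj : K.unstableModes ∩ (P.closedLoop K).unstableModes = ∅) :
    fixedModes (P.closedLoop K) (Controller.sparse Adm) (Controller.static u y) ⊆ openLHP := by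
  intro z hz
  by_contra hzl
  have hzr : z ∈ closedRHP := not_lt.1 (show ¬ z.re < 0 from hzl)
  have hgain (Δ : Matrix u y ℝ) (hΔ : ∀ i j, (i, j) ∉ Adm → Δ i j = 0)
      (hw : (P.closedLoop K).WellPosed (ofGain Δ)) :
      z ∈ eig ((P.closedLoop K).closedLoopA (ofGain Δ)) :=
    hz ⟨0, ofGain Δ⟩ ⟨isSparse_ofGain hΔ, rfl, rfl, rfl⟩ hw
  have hw0 : (P.closedLoop K).WellPosed (ofGain 0) := by simp [WellPosed, ofGain]
  -- The zero gain leaves the closed loop unchanged.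
  have hzF : z ∈ eig (P.closedLoop K).A := by
    obtain ⟨x, η, v, w, hne, hx, -, -, hv⟩ :=
      (hw0.mem_eig_closedLoopA_iff z).1 (hgain 0 (fun _ _ _ => rfl) hw0)
    obtain rfl : η = 0 := Subsingleton.elim _ _
    have hv0 : v = 0 := by rw [hv, ofGain, toComplex_zero]; simp
    rw [hv0, Matrix.mulVec_zero, add_zero] at hx
    exact (mem_eig_iff _ _).2 ⟨x, hne.resolve_right (· rfl), hx⟩
  have hzK : z ∉ eig K.A := fun h =>
    Set.eq_empty_iff_forall_notMem.1 hdisj z ⟨⟨h, hzr⟩, hzF, hzr⟩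
  refine hzl (hP ?_)
  rintro ⟨k, L⟩ ⟨hLS, hL⟩ hPL
  refine hPL.mem_eig_closedLoopA_of_isStatic hL ?_
  refine P.det_returnMatrix_eq_zero_of_real_gains z (G := K.transfer z)
    (fun i j hij => hK i j hij z hzK) (P.closedLoop K).D (fun Δ hΔ hw => ?_) fun i j hij => ?_
  · exact hPK.det_returnMatrix_transfer_add (L := ofGain Δ) hw hzK (hgain Δ hΔ hw)
  · change algebraMap ℝ ℂ (L.D i j) = 0
    rw [IsStatic.D_apply_eq_zero hL hLS hij, map_zero]
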